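/- Let $n\ge 1$, $\mathbb{S}=\{1,\dots,n\}$ and $\mathbb{W}=\{\mathcal{A},\mathcal{B}\}$ (server available / busy). Let $\mu:\mathbb{S}\to(0,1)$ be arbitrary and let $\rho_{s,s+1}\in(0,1)$ for $1\le s<n$ and $\rho_{s,s-1}\in(0,1)$ for $1<s\le n$. Under the action $\mathscr{W}$ (work) the action-dependent state moves from $s$ to $s+1$ with probability $\rho_{s,s+1}$ and otherwise stays at $s$ (it stays with probability one if $s=n$); under $\mathscr{R}$ (rest) it moves from $s$ to $s-1$ with probability $\rho_{s,s-1}$ and otherwise stays at $s$ (it stays with probability one if $s=1$). The system with arrival rate $\lambda\in(0,1)$ has states $(s,w,q)\in\mathbb{X}=\mathbb{S}\times\big((\mathbb{W}\times\mathbb{N})\setminus\{(\mathcal{B},0)\}\big)$. In one epoch a task arrives with probability $\lambda$; if the server works, it completes a task with probability $\mu(s)$. Given the current state $(s,w,q)$ and the action, the action-dependent state moves as above, independently of the next pair $(w',q')$, which is distributed as follows. Under $\mathscr{W}$, $(w',q')$ equals $(\mathcal{A},q)$, $(\mathcal{A},q-1)$, $(\mathcal{B},q+1)$, $(\mathcal{B},q)$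 with probabilities $\mu(s)\lambda$, $\mu(s)(1-\lambda)$, $(1-\mu(s))\lambda$, $(1-\mu(s))(1-\lambda)$. Under $\mathscr{R}$, $(w',q')$ equals $(\mathcal{A},q+1)$, $(\mathcal{A},q)$ with probabilities $\lambda$, $1-\lambda$. An admissible stationary randomized policy is a map $\theta:\mathbb{X}\to[0,1]$ (the probability of choosing $\mathscr{W}$) with $\theta(s,w,0)=0$ and $\theta(s,\mathcal{B},q)=1$ for $q>0$. It stabilizes the system if the resulting Markov chain on $\mathbb{X}$ has at least one recurrent communicating class, all its recurrent communicating classes are positive recurrent, and it has only finitely many transient states. For a threshold $\tau\in\{1,\dots,n+1\}$ let $\phi_\tau(s,w)=0$ if $s\ge\tau$ and $w=\mathcal{A}$, and $\phi_\tau(s,w)=1$ otherwise; let $\theta_\tau(s,w,q)=\phi_\tau(s,w)$ if $q>0$ and $\theta_\tau(s,w,0)=0$. The auxiliary chain for $\phi_\tau$ is the Markov chain on $\mathbb{S}\times\mathbb{W}$ that in state $(s,w)$ chooses $\mathscr{W}$ with probability $\phi_\tau(s,w)$ and $\mathscr{R}$ otherwise; the action-dependent state then moves as above and, independently, the next availability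 is $\mathcal{A}$ with probability $\mu(s)$ and $\mathcal{B}$ with probability $1-\mu(s)$ under $\mathscr{W}$, and is $\mathcal{A}$ under $\mathscr{R}$. **Theorem (Sufficiency).** For every $\tau\in\{1,\dots,n+1\}$ the auxiliary chain for $\phi_\tau$ has a unique stationary probability mass function $\overline{\pi}^\tau$. Put $$\lambda^*=\max_{\tau\in\{1,\dots,n+1\}}\ \sum_{(s,w)\in\mathbb{S}\times\mathbb{W}}\overline{\pi}^\tau(s,w)\,\phi_\tau(s,w)\,\mu(s),$$ and let $\tau^*$ be a threshold attaining this maximum. Then, for every arrival rate $\lambda\in(0,1)$ with $\lambda<\lambda^*$, the policy $\theta_{\tau^*}$ is admissible and stabilizes the system. -/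

import Mathlib

open scoped ENNReal BigOperators

/-! ## Discrete-time Markov chains on a countable state space -/

namespace MarkovChain

variable {α : Type*}

open Classical in
/-- The `k`-step transition probabilities of the chain with transition matrix `P`. -/
noncomputable def stepProb (P : α → α → ℝ≥0∞) : ℕ → α → α → ℝ≥0∞
  | 0, x, y => if x = y then 1 else 0
  | k + 1, x, y => ∑' z, P x z * stepProb P k z y

open Classical in
/-- First-passage probabilities: `firstPassage P k x y` is the probability, given `X₀ = x`, that
`X₁ ≠ y, …, X_{k-1} ≠ y` and `X_k = y` (so it is `0` for `k = 0`). -/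
noncomputable def firstPassage (P : α → α → ℝ≥0∞) : ℕ → α → α → ℝ≥0∞
  | 0, _, _ => 0
  | 1, x, y => P x y
  | k + 2, x, y => ∑' z, if z = y then 0 else P x z * firstPassage P (k + 1) z y

/-- `y` can be reached from `x` with positive probability in some number `k ≥ 0` of steps. -/
def Accessible (P : α → α → ℝ≥0∞) (x y : α) : Prop :=
  ∃ k : ℕ, 0 < stepProb P k x y

/-- `x` and `y` can be reached from each other. -/
def Communicate (P : α → α → ℝ≥0∞) (x y : α) : Prop :=
  Accessible P x y ∧ Accessible P y x

/-- A state is recurrent if, started there, the chain returns to it with probability one. -/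
def IsRecurrent (P : α → α → ℝ≥0∞) (x : α) : Prop :=
  ∑' k, firstPassage P k x x = 1

/-- A state is transient if it is not recurrent. -/
def IsTransient (P : α → α → ℝ≥0∞) (x : α) : Prop :=
  ¬ IsRecurrent P x

/-- A state is positive recurrent if it is recurrent and its expected return time is finite. -/
def IsPositiveRecurrent (P : α → α → ℝ≥0∞) (x : α) : Prop :=
  IsRecurrent P x ∧ ∑' k : ℕ, (k : ℝ≥0∞) * firstPassage P k x x ≠ ∞

/-- An equivalence class of the relation of communication. -/
def IsCommunicatingClass (P : α → α → ℝ≥0∞) (C : Set α) : Prop :=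
  ∃ x, C = {y | Communicate P x y}

/-- A communicating class of recurrent states. -/
def IsRecurrentClass (P : α → α → ℝ≥0∞) (C : Set α) : Prop :=
  IsCommunicatingClass P C ∧ ∀ x ∈ C, IsRecurrent P x

/-- Stability: there is a recurrent communicating class, all recurrent communicating classes are
positive recurrent, and there are finitely many transient states. -/
def IsStable (P : α → α → ℝ≥0∞) : Prop :=
  (∃ C, IsRecurrentClass P C) ∧
  (∀ C, IsRecurrentClass P C → ∀ x ∈ C, IsPositiveRecurrent P x) ∧
  {x | IsTransient P x}.Finite

/-- `π` is a stationary probability mass function of the chain with finite state space and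
transition matrix `P`. -/
def IsStationaryPMF [Fintype α] (P : α → α → ℝ) (π : α → ℝ) : Prop :=
  (∀ y, 0 ≤ π y) ∧ ∑ y, π y = 1 ∧ ∀ y, π y = ∑ x, π x * P x y

end MarkovChain

/-! ## The queueing system -/

namespace ActionQueue

/-- Availability of the server. -/
inductive Avail
  | available
  | busy
  deriving DecidableEq

instance : Fintype Avail :=
  ⟨{Avail.available, Avail.busy}, fun w => by cases w <;> simp⟩

/-- Actions that the scheduler can request. -/
inductive Action
  | rest
  | work
  deriving DecidableEq

/-- The set `{1, …, n}` of action-dependent states. -/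
abbrev ActState (n : ℕ) := {s : ℕ // s ∈ Finset.Icc 1 n}

/-- Server states `(s, w)`. -/
abbrev ServerState (n : ℕ) := ActState n × Avail

/-- System states `(s, w, q)`; the server cannot be busy when the queue is empty. -/
abbrev SysState (n : ℕ) := {x : ActState n × Avail × ℕ // x.2 ≠ (Avail.busy, 0)}

/-- The parameters of the server: the service rates `μ s` and the transition parameters
`ρ s (s + 1)`, `ρ s (s - 1)` of the action-dependent state (other values of `ρ` play no role). -/
structure Model (n : ℕ) where
  μ : ActState n → ℝ
  ρ : ℕ → ℕ → ℝ
  μ_mem : ∀ s, μ s ∈ Set.Ioo (0 : ℝ) 1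
  ρ_up_mem : ∀ s, 1 ≤ s → s < n → ρ s (s + 1) ∈ Set.Ioo (0 : ℝ) 1
  ρ_down_mem : ∀ s, 1 < s → s ≤ n → ρ s (s - 1) ∈ Set.Ioo (0 : ℝ) 1

variable {n : ℕ}

namespace Model

/-- Transition probability from `s` to `s'` of the action-dependent state under an action. -/
def actTrans (M : Model n) : Action → ActState n → ActState n → ℝ
  | .work, s, s' =>
      if s.1 < n ∧ s'.1 = s.1 + 1 then M.ρ s.1 (s.1 + 1)
      else if s.1 < n ∧ s'.1 = s.1 then 1 - M.ρ s.1 (s.1 + 1)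
      else if s.1 = n ∧ s'.1 = n then 1
      else 0
  | .rest, s, s' =>
      if 1 < s.1 ∧ s'.1 = s.1 - 1 then M.ρ s.1 (s.1 - 1)
      else if 1 < s.1 ∧ s'.1 = s.1 then 1 - M.ρ s.1 (s.1 - 1)
      else if s.1 = 1 ∧ s'.1 = 1 then 1
      else 0

/-- Transition probability from queue size `q` to availability and queue size `(w', q')` when the
action-dependent state is `s` and the arrival rate is `lam`. -/
def availQueueTrans (M : Model n) (lam : ℝ) :
    Action → ActState n → ℕ → Avail → ℕ → ℝ
  | .work, s, q, .available, q' =>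
      if q' = q then M.μ s * lam
      else if q' + 1 = q then M.μ s * (1 - lam)
      else 0
  | .work, s, q, .busy, q' =>
      if q' = q + 1 then (1 - M.μ s) * lam
      else if q' = q then (1 - M.μ s) * (1 - lam)
      else 0
  | .rest, _, q, .available, q' =>
      if q' = q + 1 then lam
      else if q' = q then 1 - lam
      else 0
  | .rest, _, _, .busy, _ => 0

/-- Transition probability of the system from `x` to `x'` under an action. -/
def sysTrans (M : Model n) (lam : ℝ) (a : Action) (x x' : SysState n) : ℝ :=
  M.actTrans a x.1.1 x'.1.1 * M.availQueueTrans lam a x.1.1 x.1.2.2 x'.1.2.1 x'.1.2.2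

/-- Transition matrix of the system under the stationary randomized policy that works with
probability `θ x` in state `x`. -/
noncomputable def sysChain (M : Model n) (lam : ℝ) (θ : SysState n → ℝ)
    (x x' : SysState n) : ℝ≥0∞ :=
  ENNReal.ofReal
    (θ x * M.sysTrans lam .work x x' + (1 - θ x) * M.sysTrans lam .rest x x')

end Model

/-- Admissible stationary randomized policies: rest when the queue is empty, continue to work
while the server is busy. -/
def IsAdmissible (θ : SysState n → ℝ) : Prop :=
  ∀ x : SysState n, θ x ∈ Set.Icc (0 : ℝ) 1 ∧
    (x.1.2.2 = 0 → θ x = 0) ∧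
    (0 < x.1.2.2 → x.1.2.1 = Avail.busy → θ x = 1)

/-- The threshold policy on server states. -/
def phi (τ : ℕ) (y : ServerState n) : ℝ :=
  if τ ≤ y.1.1 ∧ y.2 = Avail.available then 0 else 1

/-- The threshold policy on system states. -/
def theta (τ : ℕ) (x : SysState n) : ℝ :=
  if 0 < x.1.2.2 then phi τ (x.1.1, x.1.2.1) else 0

namespace Model

/-- The admissible policy `θ` stabilizes the system with arrival rate `lam`. -/
def Stabilizes (M : Model n) (lam : ℝ) (θ : SysState n → ℝ) : Prop :=
  IsAdmissible θ ∧ MarkovChain.IsStable (M.sysChain lam θ)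

/-- Transition probability of the availability in the auxiliary chain (queue never empty). -/
def auxAvailTrans (M : Model n) : Action → ActState n → Avail → ℝ
  | .work, s, .available => M.μ s
  | .work, s, .busy => 1 - M.μ s
  | .rest, _, .available => 1
  | .rest, _, .busy => 0

/-- Transition probability of the auxiliary chain from `y` to `y'` under an action. -/
def auxTrans (M : Model n) (a : Action) (y y' : ServerState n) : ℝ :=
  M.actTrans a y.1 y'.1 * M.auxAvailTrans a y.1 y'.2

/-- Transition matrix of the auxiliary chain under the stationary randomized policy `φ`. -/
def auxChain (M : Model n) (φ : ServerState n → ℝ) (y y' : ServerState n) : ℝ :=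
  φ y * M.auxTrans .work y y' + (1 - φ y) * M.auxTrans .rest y y'

/-- The stationary probability mass function of the auxiliary chain under the threshold policy
with threshold `τ`. -/
noncomputable def piBar (M : Model n) (τ : ℕ) : ServerState n → ℝ :=
  Classical.epsilon (MarkovChain.IsStationaryPMF (M.auxChain (phi τ)))

/-- The long-term service rate of the threshold policy with threshold `τ` in the auxiliary
chain. -/
noncomputable def serviceRate (M : Model n) (τ : ℕ) : ℝ :=
  ∑ y : ServerState n, M.piBar τ y * phi τ y * M.μ y.1

/-- The maximal long-term service rate over all thresholds in `{1, …, n + 1}`. -/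
noncomputable def lambdaStar (M : Model n) : ℝ :=
  (Finset.Icc 1 (n + 1)).sup' (Finset.nonempty_Icc.2 (Nat.le_add_left 1 n)) M.serviceRate

end Model

end ActionQueue

/-!
The service probability `φ μ` of the auxiliary chain differs from step to step, but its long-term
average is the service rate `ν` of the threshold policy. Since the auxiliary chain has a unique
stationary distribution `π`, the Poisson equation `P h - h = φ μ - ν` is solvable
(`MarkovChain.exists_poisson_solution`): by uniqueness every invariant row vector is a multiple of
`π`, so the range of `P - 1` consists of all functions with `π`-mean zero. While the queue is not
empty, the server state `(s, w)` of the system evolves as the auxiliary chain and the queue size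
has conditional drift `lam - φ μ`. Hence `q + h (s, w)` has constant drift `lam - ν`, negative
precisely when `lam < ν`, outside the finite set of states with an empty queue.

Foster's criterion (`MarkovChain.isPositiveRecurrent_of_foster`) turns this into positive
recurrence of every state that is accessible from all others. It is proved for the first-passage
definition of recurrence by modifying the Lyapunov function so that the drift is negative off a
single state, where it bounds the expected return time directly.

No state is transient: `0 < lam < ν` forces the threshold to be at least `2`
(`ActionQueue.Model.serviceRate_eq_zero`), and then all states of the system communicate
(`ActionQueue.Model.accessible_sysChain_theta`). Optimality of the threshold is used only to
identify `ν` with `lambdaStar`.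
-/

/-! ### Positive recurrence from a drift condition -/

namespace MarkovChain

variable {α : Type*}

open Classical in
/-- The probability, given `X₀ = x`, that none of `X₀, …, X_k` equals `y`. -/
noncomputable def avoidProb (P : α → α → ℝ≥0∞) (y : α) : ℕ → α → ℝ≥0∞
  | 0, x => if x = y then 0 else 1
  | k + 1, x => if x = y then 0 else ∑' z, P x z * avoidProb P y k z

lemma avoidProb_self (P : α → α → ℝ≥0∞) (y : α) (k : ℕ) : avoidProb P y k y = 0 := by
  cases k <;> simp [avoidProb]

lemma avoidProb_succ_of_ne (P : α → α → ℝ≥0∞) {x y : α} (h : x ≠ y) (k : ℕ) :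
    avoidProb P y (k + 1) x = ∑' z, P x z * avoidProb P y k z := by
  simp [avoidProb, h]

lemma avoidProb_add_stepProb_le {P : α → α → ℝ≥0∞} (hP : ∀ x, ∑' z, P x z = 1) (y : α)
    (k : ℕ) (x : α) : avoidProb P y k x + stepProb P k x y ≤ 1 := by
  induction k generalizing x with
  | zero => by_cases h : x = y <;> simp [avoidProb, stepProb, h]
  | succ k ih =>
    have h1 : avoidProb P y (k + 1) x ≤ ∑' z, P x z * avoidProb P y k z := by
      by_cases h : x = y <;> simp [avoidProb, h]
    calc avoidProb P y (k + 1) x + stepProb P (k + 1) x y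
        ≤ ∑' z, P x z * avoidProb P y k z + ∑' z, P x z * stepProb P k z y :=
          add_le_add h1 le_rfl
      _ = ∑' z, P x z * (avoidProb P y k z + stepProb P k z y) := by
          rw [← ENNReal.tsum_add]; simp only [mul_add]
      _ ≤ ∑' z, P x z * 1 := ENNReal.tsum_le_tsum fun z => by gcongr; exact ih z
      _ = 1 := by simp [hP]

lemma avoidProb_le_one {P : α → α → ℝ≥0∞} (hP : ∀ x, ∑' z, P x z = 1) (y : α)
    (k : ℕ) (x : α) : avoidProb P y k x ≤ 1 :=
  le_self_add.trans (avoidProb_add_stepProb_le hP y k x)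

lemma avoidProb_antitone {P : α → α → ℝ≥0∞} (hP : ∀ x, ∑' z, P x z = 1) (y x : α) :
    Antitone fun k => avoidProb P y k x := by
  refine antitone_nat_of_succ_le fun k => ?_
  induction k generalizing x with
  | zero =>
    by_cases h : x = y
    · simp [avoidProb, h]
    · simpa [avoidProb, h] using avoidProb_le_one hP y 1 x
  | succ k ih =>
    by_cases h : x = y
    · simp [avoidProb, h]
    · rw [avoidProb_succ_of_ne P h, avoidProb_succ_of_ne P h]
      exact ENNReal.tsum_le_tsum fun z => by gcongr; exact ih z

lemma firstPassage_one_add_tsum_avoidProb {P : α → α → ℝ≥0∞} (hP : ∀ x, ∑' z, P x z = 1)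
    (x y : α) : firstPassage P 1 x y + ∑' z, P x z * avoidProb P y 0 z = 1 := by
  classical
  rw [← hP x, ENNReal.tsum_eq_add_tsum_ite (f := fun z => P x z) y]
  simp [firstPassage, avoidProb]

/-- Every visit-free stretch either continues for one more step or ends with a first visit. -/
lemma firstPassage_add_tsum_avoidProb {P : α → α → ℝ≥0∞} (hP : ∀ x, ∑' z, P x z = 1) (y : α)
    (k : ℕ) (x : α) :
    firstPassage P (k + 2) x y + ∑' z, P x z * avoidProb P y (k + 1) z
      = ∑' z, P x z * avoidProb P y k z := by
  classical
  have key : ∀ k x, x ≠ y → firstPassage P (k + 1) x y + avoidProb P y (k + 1) x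
      = avoidProb P y k x := by
    intro k
    induction k with
    | zero =>
      intro x hx
      rw [avoidProb_succ_of_ne P hx, zero_add, firstPassage_one_add_tsum_avoidProb hP]
      simp [avoidProb, hx]
    | succ k ih =>
      intro x hx
      rw [avoidProb_succ_of_ne P hx, avoidProb_succ_of_ne P hx]
      simp only [firstPassage]
      rw [← ENNReal.tsum_add]
      refine tsum_congr fun z => ?_
      by_cases h : z = y
      · simp [h, avoidProb_self]
      · rw [if_neg h, ← mul_add, ih z h]
  simp only [firstPassage]
  rw [← ENNReal.tsum_add]
  refine tsum_congr fun z => ?_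
  by_cases h : z = y
  · simp [h, avoidProb_self]
  · rw [if_neg h, ← mul_add, key k z h]

/-- If the tail probabilities `g k` of a distribution `f` on the positive integers are summable,
then `f` has total mass one and finite mean. -/
lemma tsum_eq_one_and_mean_ne_top_of_tail {f g : ℕ → ℝ≥0∞} (h0 : f 0 = 0) (hg0 : g 0 = 1)
    (hfg : ∀ k, f (k + 1) + g (k + 1) = g k) (hsum : ∑' k, g k ≠ ∞) :
    ∑' k, f k = 1 ∧ ∑' k : ℕ, (k : ℝ≥0∞) * f k ≠ ∞ := by
  have hpart : ∀ N, ∑ k ∈ Finset.range (N + 1), f k + g N = 1 := by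
    intro N
    induction N with
    | zero => simp [h0, hg0]
    | succ N ih => rw [Finset.sum_range_succ, add_assoc, hfg, ih]
  have hlim : Filter.Tendsto g Filter.atTop (nhds 0) :=
    ENNReal.tendsto_atTop_zero_of_tsum_ne_top hsum
  constructor
  · have h1 : Filter.Tendsto (fun N => ∑ k ∈ Finset.range (N + 1), f k + g N) Filter.atTop
        (nhds (∑' k, f k + 0)) :=
      ((ENNReal.tendsto_nat_tsum f).comp (Filter.tendsto_add_atTop_nat 1)).add hlim
    simp only [hpart, add_zero] at h1
    exact tendsto_nhds_unique h1 tendsto_const_nhds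
  · have hmean : ∀ N : ℕ, ∑ k ∈ Finset.range (N + 1), (k : ℝ≥0∞) * f k + N * g N
        = ∑ k ∈ Finset.range N, g k := by
      intro N
      induction N with
      | zero => simp
      | succ N ih =>
        rw [Finset.sum_range_succ, Finset.sum_range_succ g, ← ih, ← hfg N]
        push_cast
        ring
    refine ne_top_of_le_ne_top hsum ?_
    refine ENNReal.tsum_le_of_sum_range_le fun N => ?_
    calc ∑ k ∈ Finset.range N, (k : ℝ≥0∞) * f k
        ≤ ∑ k ∈ Finset.range (N + 1), (k : ℝ≥0∞) * f k + N * g N :=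
          (Finset.sum_le_sum_of_subset (Finset.range_mono N.le_succ)).trans le_self_add
      _ = ∑ k ∈ Finset.range N, g k := hmean N
      _ ≤ ∑' k, g k := ENNReal.sum_le_tsum _

/-- A Lyapunov function with drift at most `-1` in every state other than `y` bounds the expected
time to reach `y`, so that `y` is positive recurrent. -/
lemma isPositiveRecurrent_of_drift_off_state {P : α → α → ℝ≥0∞} (hP : ∀ x, ∑' z, P x z = 1)
    (y : α) (W : α → ℝ≥0∞) (hy : ∑' z, P y z * W z ≠ ∞)
    (hW : ∀ x, x ≠ y → ∑' z, P x z * W z + 1 ≤ W x) : IsPositiveRecurrent P y := by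
  have hpart : ∀ N x, ∑ k ∈ Finset.range N, avoidProb P y k x ≤ W x := by
    intro N
    induction N with
    | zero => simp
    | succ N ih =>
      intro x
      by_cases h : x = y
      · simp [h, avoidProb_self]
      rw [Finset.sum_range_succ']
      refine le_trans ?_ (hW x h)
      have h0 : avoidProb P y 0 x = 1 := by simp [avoidProb, h]
      rw [h0]
      gcongr
      simp only [avoidProb_succ_of_ne P h]
      rw [← Summable.tsum_finsetSum fun _ _ => ENNReal.summable]
      refine ENNReal.tsum_le_tsum fun z => ?_
      rw [← Finset.mul_sum]
      gcongr
      exact ih z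
  have hsum : ∀ x, ∑' k, avoidProb P y k x ≤ W x := fun x =>
    ENNReal.tsum_le_of_sum_range_le fun N => hpart N x
  -- `g k` is the probability of no return to `y` at the times `1, …, k`.
  let g : ℕ → ℝ≥0∞ := fun k => Nat.casesOn k 1 fun j => ∑' z, P y z * avoidProb P y j z
  refine tsum_eq_one_and_mean_ne_top_of_tail (f := fun k => firstPassage P k y y) (g := g)
    (by simp [firstPassage]) rfl (fun k => ?_) ?_
  · cases k with
    | zero => exact firstPassage_one_add_tsum_avoidProb hP y y
    | succ k => exact firstPassage_add_tsum_avoidProb hP y k y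
  · rw [tsum_eq_zero_add' ENNReal.summable]
    refine ENNReal.add_ne_top.2 ⟨by simp [g], ?_⟩
    refine ne_top_of_le_ne_top hy ?_
    change ∑' j, ∑' z, P y z * avoidProb P y j z ≤ _
    rw [ENNReal.tsum_comm]
    refine ENNReal.tsum_le_tsum fun z => ?_
    rw [ENNReal.tsum_mul_left]
    gcongr
    exact hsum z

/-- Foster's criterion: if `y` is accessible from every state and `V` has drift at most `-1`
outside a finite set `C`, then `y` is positive recurrent.

With `T` the hitting time of `y`, the bounded function `U x = 𝔼ₓ[min T K]` has drift `-ℙₓ(T ≤ K)`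
off `y`, which is bounded away from zero on `C` for large `K`. Adding a large multiple of `U` to `V`
gives a function with drift at most `-1` off `y`. -/
theorem isPositiveRecurrent_of_foster {P : α → α → ℝ≥0∞} (hP : ∀ x, ∑' z, P x z = 1)
    (V : α → ℝ≥0∞) (hPV : ∀ x, ∑' z, P x z * V z ≠ ∞)
    {C : Set α} (hC : C.Finite) (hdrift : ∀ x, x ∉ C → ∑' z, P x z * V z + 1 ≤ V x)
    (y : α) (hacc : ∀ x, Accessible P x y) : IsPositiveRecurrent P y := by
  have hlt : ∀ x, ∃ k, avoidProb P y k x < 1 := by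
    intro x
    obtain ⟨k, hk⟩ := hacc x
    refine ⟨k, lt_of_lt_of_le ?_ (avoidProb_add_stepProb_le hP y k x)⟩
    exact ENNReal.lt_add_right
      (ne_top_of_le_ne_top ENNReal.one_ne_top (avoidProb_le_one hP y k x)) hk.ne'
  choose κ hκ using hlt
  let F := hC.toFinset
  let K := F.sup κ
  let ε : ℝ≥0∞ := F.inf fun x => 1 - avoidProb P y K x
  have hεpos : 0 < ε := by
    rw [Finset.lt_inf_iff (by simp)]
    intro x hx
    exact tsub_pos_of_lt ((avoidProb_antitone hP y x (Finset.le_sup hx)).trans_lt (hκ x))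
  -- The infimum over an empty `C` is `∞`, hence the truncation at `1`.
  have hε : ∀ x ∈ C, avoidProb P y K x + min ε 1 ≤ 1 := by
    intro x hx
    calc avoidProb P y K x + min ε 1 ≤ avoidProb P y K x + (1 - avoidProb P y K x) := by
          gcongr
          exact (min_le_left _ _).trans (Finset.inf_le (hC.mem_toFinset.2 hx))
      _ = 1 := add_tsub_cancel_of_le (avoidProb_le_one hP y K x)
  set δ := min ε 1 with hδ
  have hδ0 : δ ≠ 0 := (lt_min hεpos one_pos).ne'
  have hδt : δ ≠ ∞ := ne_top_of_le_ne_top ENNReal.one_ne_top (min_le_right _ _)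
  let b : ℝ≥0∞ := ∑ x ∈ F, ∑' z, P x z * V z + 1
  have hb : b ≠ ∞ := by
    simp only [b]
    exact ENNReal.add_ne_top.2 ⟨ENNReal.sum_ne_top.2 fun x _ => hPV x, ENNReal.one_ne_top⟩
  -- On `C` the drift of `V` is at most `b - 1`, and that of `A * U` is at most `-A * δ = -b`.
  let A := b / δ
  have hAt : A ≠ ∞ := ENNReal.div_ne_top hb hδ0
  have hAδ : A * δ = b := ENNReal.div_mul_cancel hδ0 hδt
  let U : α → ℝ≥0∞ := fun x => ∑ k ∈ Finset.range K, avoidProb P y k x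
  have hPU_le : ∀ x, ∑' z, P x z * U z ≤ K := by
    intro x
    calc ∑' z, P x z * U z ≤ ∑' z, P x z * K := by
          refine ENNReal.tsum_le_tsum fun z => ?_
          gcongr
          calc U z ≤ ∑ k ∈ Finset.range K, (1 : ℝ≥0∞) :=
                Finset.sum_le_sum fun k _ => avoidProb_le_one hP y k z
            _ = K := by simp
      _ = K := by rw [ENNReal.tsum_mul_right, hP, one_mul]
  have hPU : ∀ x, x ≠ y → ∑' z, P x z * U z + 1 = U x + avoidProb P y K x := by
    intro x hx
    have h0 : avoidProb P y 0 x = 1 := by simp [avoidProb, hx]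
    simp only [U]
    rw [← Finset.sum_range_succ, Finset.sum_range_succ', h0]
    congr 1
    simp only [Finset.mul_sum]
    rw [Summable.tsum_finsetSum fun _ _ => ENNReal.summable]
    simp only [avoidProb_succ_of_ne P hx]
  have hPW : ∀ x, ∑' z, P x z * (V z + A * U z)
      = ∑' z, P x z * V z + A * ∑' z, P x z * U z := by
    intro x
    rw [← ENNReal.tsum_mul_left, ← ENNReal.tsum_add]
    refine tsum_congr fun z => ?_
    ring
  refine isPositiveRecurrent_of_drift_off_state hP y (fun x => V x + A * U x) ?_ ?_
  · rw [hPW]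
    exact ENNReal.add_ne_top.2 ⟨hPV y, ENNReal.mul_ne_top hAt
      (ne_top_of_le_ne_top (ENNReal.natCast_ne_top K) (hPU_le y))⟩
  · intro x hx
    rw [hPW]
    by_cases hxC : x ∈ C
    · have h1 : ∑' z, P x z * U z + δ ≤ U x := by
        have hfin : (1 : ℝ≥0∞) ≠ ∞ := ENNReal.one_ne_top
        refine (ENNReal.add_le_add_iff_right hfin).1 ?_
        calc ∑' z, P x z * U z + δ + 1 = ∑' z, P x z * U z + 1 + δ := by ring
          _ = U x + (avoidProb P y K x + δ) := by rw [hPU x hx, add_assoc]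
          _ ≤ U x + 1 := by gcongr; exact hε x hxC
      have h2 : ∑' z, P x z * V z + 1 ≤ b := by
        simp only [b]
        gcongr
        exact Finset.single_le_sum (f := fun x => ∑' z, P x z * V z) (fun _ _ => zero_le)
          (hC.mem_toFinset.2 hxC)
      calc ∑' z, P x z * V z + A * ∑' z, P x z * U z + 1
          = ∑' z, P x z * V z + 1 + A * ∑' z, P x z * U z := by ring
        _ ≤ A * δ + A * ∑' z, P x z * U z := by rw [hAδ]; gcongr
        _ = A * (∑' z, P x z * U z + δ) := by ring
        _ ≤ A * U x := by gcongr
        _ ≤ V x + A * U x := le_add_self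
    · have h1 : ∑' z, P x z * U z ≤ U x := by
        have hfin : (1 : ℝ≥0∞) ≠ ∞ := ENNReal.one_ne_top
        refine (ENNReal.add_le_add_iff_right hfin).1 ?_
        rw [hPU x hx]
        gcongr
        exact avoidProb_le_one hP y K x
      calc ∑' z, P x z * V z + A * ∑' z, P x z * U z + 1
          = ∑' z, P x z * V z + 1 + A * ∑' z, P x z * U z := by ring
        _ ≤ V x + A * U x := by gcongr; exact hdrift x hxC

/-- A path of transitions of positive probability witnesses accessibility. -/
lemma accessible_of_reflTransGen {P : α → α → ℝ≥0∞} {x y : α}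
    (h : Relation.ReflTransGen (fun x z => 0 < P x z) x y) : Accessible P x y := by
  induction h using Relation.ReflTransGen.head_induction_on with
  | refl => exact ⟨0, by simp [stepProb]⟩
  | head hxz _ ih =>
    obtain ⟨k, hk⟩ := ih
    refine ⟨k + 1, ?_⟩
    exact (ENNReal.mul_pos hxz.ne' hk.ne').trans_le
      (ENNReal.le_tsum (f := fun z => P _ z * stepProb P k z y) _)

/-- A chain all of whose states are positive recurrent is stable. -/
lemma isStable_of_forall_isPositiveRecurrent [Nonempty α] {P : α → α → ℝ≥0∞}
    (h : ∀ x, IsPositiveRecurrent P x) : IsStable P := by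
  refine ⟨⟨_, ⟨Classical.arbitrary α, rfl⟩, fun x _ => (h x).1⟩, fun _ _ x _ => h x, ?_⟩
  have : {x | IsTransient P x} = ∅ := by
    ext x
    simp [IsTransient, (h x).1]
  rw [this]
  exact Set.finite_empty

end MarkovChain

/-! ### Stationary distributions and the Poisson equation of a finite chain -/

namespace MarkovChain

variable {α : Type*} [Fintype α]

/-- The total mass is preserved by a stochastic matrix, so the entrywise inequality
`|v| ≤ |v| P` for an invariant signed vector `v` is an equality. -/
lemma abs_invariant {P : α → α → ℝ} (hP0 : ∀ x y, 0 ≤ P x y) (hP : ∀ x, ∑ y, P x y = 1)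
    {v : α → ℝ} (hv : ∀ y, v y = ∑ x, v x * P x y) (y : α) : |v y| = ∑ x, |v x| * P x y := by
  have hle : ∀ y ∈ Finset.univ, |v y| ≤ ∑ x, |v x| * P x y := by
    intro y _
    conv_lhs => rw [hv y]
    refine (Finset.abs_sum_le_sum_abs _ _).trans_eq ?_
    simp only [abs_mul, abs_of_nonneg (hP0 _ _)]
  have hsum : ∑ y, |v y| = ∑ y, ∑ x, |v x| * P x y := by
    rw [Finset.sum_comm]
    simp only [← Finset.mul_sum, hP, mul_one]
  exact (Finset.sum_eq_sum_iff_of_le hle).1 hsum y (Finset.mem_univ y)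

/-- A nonnegative invariant vector is positive in every state accessible from its support. -/
lemma pos_of_reflTransGen {P : α → α → ℝ} (hP0 : ∀ x y, 0 ≤ P x y)
    {u : α → ℝ} (hu0 : ∀ x, 0 ≤ u x) (hu : ∀ y, u y = ∑ x, u x * P x y) {x y : α} (hx : 0 < u x)
    (h : Relation.ReflTransGen (fun x z => 0 < P x z) x y) : 0 < u y := by
  induction h with
  | refl => exact hx
  | tail _ hbc ih =>
    rw [hu]
    exact (mul_pos ih hbc).trans_le (Finset.single_le_sum (f := fun x => u x * P x _)
      (fun x _ => mul_nonneg (hu0 x) (hP0 x _)) (Finset.mem_univ _))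

/-- A stochastic matrix has a nonzero invariant vector, since it fixes the constant column. -/
lemma exists_ne_zero_invariant [Nonempty α] {P : α → α → ℝ} (hP : ∀ x, ∑ y, P x y = 1) :
    ∃ v : α → ℝ, v ≠ 0 ∧ ∀ y, v y = ∑ x, v x * P x y := by
  classical
  let A : Matrix α α ℝ := 1 - Matrix.of P
  have hdet : A.det = 0 := by
    refine Matrix.exists_mulVec_eq_zero_iff.1 ⟨fun _ => 1, ?_, ?_⟩
    · intro h
      exact one_ne_zero (congrFun h (Classical.arbitrary α))
    · ext x
      simp [A, Matrix.mulVec, dotProduct, Matrix.one_apply, hP]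
  obtain ⟨v, hv0, hv⟩ := Matrix.exists_vecMul_eq_zero_iff.2 hdet
  refine ⟨v, hv0, fun y => ?_⟩
  have := congrFun hv y
  simp only [A, Matrix.vecMul_sub, Matrix.vecMul_one, Pi.sub_apply, Pi.zero_apply] at this
  simpa [Matrix.vecMul, dotProduct] using sub_eq_zero.1 this

lemma isStationaryPMF_normalize {P : α → α → ℝ} {u : α → ℝ} (hu0 : ∀ x, 0 ≤ u x)
    (hu : ∀ y, u y = ∑ x, u x * P x y) (hne : ∑ x, u x ≠ 0) :
    IsStationaryPMF P fun y => (∑ x, u x)⁻¹ * u y := by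
  refine ⟨fun y => mul_nonneg (inv_nonneg.2 (Finset.sum_nonneg fun x _ => hu0 x)) (hu0 y), ?_,
    fun y => ?_⟩
  · rw [← Finset.mul_sum, inv_mul_cancel₀ hne]
  · change (∑ x, u x)⁻¹ * u y = _
    rw [hu y, Finset.mul_sum]
    simp only [mul_assoc]

lemma exists_isStationaryPMF [Nonempty α] {P : α → α → ℝ} (hP0 : ∀ x y, 0 ≤ P x y)
    (hP : ∀ x, ∑ y, P x y = 1) : ∃ π, IsStationaryPMF P π := by
  obtain ⟨v, hv0, hv⟩ := exists_ne_zero_invariant hP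
  refine ⟨_, isStationaryPMF_normalize (fun x => abs_nonneg (v x)) (abs_invariant hP0 hP hv) ?_⟩
  intro h
  apply hv0
  ext x
  simpa using (Finset.sum_eq_zero_iff_of_nonneg fun x _ => abs_nonneg (v x)).1 h x
    (Finset.mem_univ x)

/-- If some state `o` is accessible from every state, then the stationary distribution is unique:
the positive and negative parts of the difference of two of them would both charge `o`. -/
theorem existsUnique_isStationaryPMF [Nonempty α] {P : α → α → ℝ} (hP0 : ∀ x y, 0 ≤ P x y)
    (hP : ∀ x, ∑ y, P x y = 1) (o : α)
    (ho : ∀ x, Relation.ReflTransGen (fun x z => 0 < P x z) x o) :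
    ∃! π, IsStationaryPMF P π := by
  obtain ⟨π, hπ⟩ := exists_isStationaryPMF hP0 hP
  refine ⟨π, hπ, fun σ hσ => ?_⟩
  let v : α → ℝ := fun x => σ x - π x
  have hv : ∀ y, v y = ∑ x, v x * P x y := by
    intro y
    simp only [v, sub_mul, Finset.sum_sub_distrib, ← hσ.2.2 y, ← hπ.2.2 y]
  have hvsum : ∑ x, v x = 0 := by
    simp only [v, Finset.sum_sub_distrib, hσ.2.1, hπ.2.1, sub_self]
  have habs := abs_invariant hP0 hP hv
  have hneg : ∀ x, v x < 0 → 0 < |v o| - v o := fun x hx =>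
    pos_of_reflTransGen (u := fun x => |v x| - v x) hP0
      (fun x => sub_nonneg.2 (le_abs_self _))
      (fun y => by simp only [sub_mul, Finset.sum_sub_distrib, ← habs y, ← hv y])
      (by have := abs_nonneg (v x); change 0 < |v x| - v x; linarith) (ho x)
  have hpos : ∀ x, 0 < v x → 0 < |v o| + v o := fun x hx =>
    pos_of_reflTransGen (u := fun x => |v x| + v x) hP0
      (fun x => by have := neg_abs_le (v x); change 0 ≤ |v x| + v x; linarith)
      (fun y => by simp only [add_mul, Finset.sum_add_distrib, ← habs y, ← hv y])
      (by have := abs_nonneg (v x); change 0 < |v x| + v x; linarith) (ho x)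
  have hzero : ∀ x, v x = 0 := by
    by_contra! hne
    obtain ⟨x, hx⟩ := hne
    obtain ⟨a, -, ha⟩ := Finset.exists_pos_of_sum_zero_of_exists_nonzero v hvsum
      ⟨x, Finset.mem_univ x, hx⟩
    obtain ⟨b, -, hb⟩ := Finset.exists_pos_of_sum_zero_of_exists_nonzero (fun x => -v x)
      (by simp [hvsum]) ⟨x, Finset.mem_univ x, neg_ne_zero.2 hx⟩
    have h1 := hpos a ha
    have h2 := hneg b (neg_pos.1 hb)
    rcases abs_cases (v o) with h | h <;> linarith
  ext x
  exact sub_eq_zero.1 (hzero x)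

/-- Every invariant signed vector is a multiple of the unique stationary distribution. -/
lemma eq_sum_mul_of_invariant {P : α → α → ℝ} (hP0 : ∀ x y, 0 ≤ P x y)
    (hP : ∀ x, ∑ y, P x y = 1) {π : α → ℝ} (huniq : ∀ σ, IsStationaryPMF P σ → σ = π)
    {v : α → ℝ} (hv : ∀ y, v y = ∑ x, v x * P x y) (y : α) : v y = (∑ x, v x) * π y := by
  have hnonneg : ∀ u : α → ℝ, (∀ x, 0 ≤ u x) → (∀ y, u y = ∑ x, u x * P x y) →
      u y = (∑ x, u x) * π y := by
    intro u hu0 hu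
    by_cases hne : ∑ x, u x = 0
    · rw [hne, zero_mul]
      exact (Finset.sum_eq_zero_iff_of_nonneg fun x _ => hu0 x).1 hne y (Finset.mem_univ y)
    · rw [← congrFun (huniq _ (isStationaryPMF_normalize hu0 hu hne)) y,
        mul_inv_cancel_left₀ hne]
  have habs := abs_invariant hP0 hP hv
  have h1 := hnonneg (fun x => |v x|) (fun x => abs_nonneg _) habs
  have h2 := hnonneg (fun x => |v x| + v x)
    (fun x => by have := neg_abs_le (v x); change 0 ≤ |v x| + v x; linarith)
    (fun y => by simp only [add_mul, Finset.sum_add_distrib, ← habs y, ← hv y])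
  simp only [Finset.sum_add_distrib, add_mul] at h2
  linarith

/-- Solvability of the Poisson equation: the range of `P - 1` is the annihilator of the invariant
vectors, all of which are multiples of `π`. Adding a constant makes the solution nonnegative. -/
theorem exists_poisson_solution {P : α → α → ℝ} (hP0 : ∀ x y, 0 ≤ P x y)
    (hP : ∀ x, ∑ y, P x y = 1) {π : α → ℝ} (hπ : IsStationaryPMF P π)
    (huniq : ∀ σ, IsStationaryPMF P σ → σ = π) (c : α → ℝ) :
    ∃ h : α → ℝ, (∀ x, 0 ≤ h x) ∧ ∀ x, ∑ y, P x y * h y = h x + c x - ∑ y, π y * c y := by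
  classical
  let T : (α → ℝ) →ₗ[ℝ] (α → ℝ) := Matrix.toLin' (Matrix.of P - 1)
  have hT : ∀ h x, T h x = ∑ y, P x y * h y - h x := by
    intro h x
    simp [T, Matrix.mulVec_apply_eq_sum]
  have hmem : (fun x => c x - ∑ y, π y * c y) ∈ LinearMap.range T := by
    by_contra hnot
    obtain ⟨f, hf, hf0⟩ := Submodule.exists_dual_map_eq_bot_of_notMem hnot inferInstance
    let v : α → ℝ := fun x => f (Pi.single x 1)
    have hfv : ∀ g : α → ℝ, f g = ∑ x, g x * v x := by
      intro g
      conv_lhs => rw [← Finset.univ_sum_single g]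
      rw [map_sum]
      refine Finset.sum_congr rfl fun x _ => ?_
      have : Pi.single x (g x) = g x • (Pi.single x (1 : ℝ) : α → ℝ) := by
        rw [← Pi.single_smul]; simp
      rw [this, map_smul, smul_eq_mul]
    have hfT : ∀ h, f (T h) = 0 := fun h => by
      have : f (T h) ∈ (LinearMap.range T).map f := ⟨T h, ⟨h, rfl⟩, rfl⟩
      rw [hf0] at this
      simpa using this
    have hv : ∀ y, v y = ∑ x, v x * P x y := by
      intro y
      have := hfT (Pi.single y 1)
      rw [hfv] at this
      simp only [hT, sub_mul, Finset.sum_sub_distrib] at this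
      simp only [Pi.single_apply, mul_ite, mul_one, mul_zero, Finset.sum_ite_eq', Finset.mem_univ,
        if_true, ite_mul, one_mul, zero_mul] at this
      rw [sub_eq_zero] at this
      rw [← this]
      exact Finset.sum_congr rfl fun x _ => mul_comm _ _
    apply hf
    rw [hfv]
    calc ∑ x, (c x - ∑ y, π y * c y) * v x
        = ∑ x, (c x - ∑ y, π y * c y) * ((∑ x, v x) * π x) :=
          Finset.sum_congr rfl fun x _ => by rw [← eq_sum_mul_of_invariant hP0 hP huniq hv x]
      _ = (∑ x, v x) * (∑ x, π x * c x - (∑ y, π y * c y) * ∑ x, π x) := by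
          rw [Finset.mul_sum, ← Finset.sum_sub_distrib, Finset.mul_sum]
          exact Finset.sum_congr rfl fun x _ => by ring
      _ = 0 := by rw [hπ.2.1]; ring
  obtain ⟨h, hh⟩ := hmem
  refine ⟨fun x => h x + ∑ y, |h y|, fun x => ?_, fun x => ?_⟩
  · have h1 := Finset.single_le_sum (f := fun y => |h y|) (fun y _ => abs_nonneg _)
      (Finset.mem_univ x)
    have h2 := neg_abs_le (h x)
    linarith
  · have := congrFun hh x
    rw [hT] at this
    simp only [mul_add, Finset.sum_add_distrib, ← Finset.sum_mul, hP, one_mul]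
    linarith

end MarkovChain

/-! ### One-step transitions of the queueing system -/

namespace ActionQueue

open MarkovChain

variable {n : ℕ}

lemma sum_avail (f : Avail → ℝ) : ∑ w, f w = f .available + f .busy := by
  change ∑ w ∈ {Avail.available, Avail.busy}, f w = _
  rw [Finset.sum_pair (by simp)]

/-- The action chosen by the threshold policy in a server state when the queue is not empty. -/
def serverAction (τ : ℕ) (y : ServerState n) : Action :=
  if τ ≤ y.1.1 ∧ y.2 = Avail.available then .rest else .work

/-- The action chosen by the threshold policy in a system state. -/
def sysAction (τ : ℕ) (x : SysState n) : Action :=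
  if 0 < x.1.2.2 then serverAction τ (x.1.1, x.1.2.1) else .rest

lemma ite_serverAction (τ : ℕ) (y : ServerState n) (c : ℝ) :
    (if serverAction τ y = .work then c else 0) = phi τ y * c := by
  unfold serverAction phi
  by_cases h : τ ≤ y.1.1 ∧ y.2 = Avail.available <;> simp [h]

lemma isAdmissible_theta (τ : ℕ) : IsAdmissible (theta τ : SysState n → ℝ) := by
  refine fun x => ⟨?_, fun h => by simp [theta, h], fun h hb => by simp [theta, phi, h, hb]⟩
  unfold theta phi
  split_ifs <;> simp

namespace Model

lemma actTrans_nonneg (M : Model n) (a : Action) (s s' : ActState n) : 0 ≤ M.actTrans a s s' := by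
  have hs := Finset.mem_Icc.1 s.2
  cases a
  · by_cases h : 1 < s.1
    · have := M.ρ_down_mem s.1 h hs.2
      simp only [actTrans]
      split_ifs <;> linarith [this.1, this.2]
    · simp only [actTrans, h, false_and, if_false]
      split_ifs <;> norm_num
  · by_cases h : s.1 < n
    · have := M.ρ_up_mem s.1 hs.1 h
      simp only [actTrans]
      split_ifs <;> linarith [this.1, this.2]
    · simp only [actTrans, h, false_and, if_false]
      split_ifs <;> norm_num

lemma sum_actTrans (M : Model n) (a : Action) (s : ActState n) : ∑ s', M.actTrans a s s' = 1 := by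
  have hs := Finset.mem_Icc.1 s.2
  cases a
  · by_cases h : 1 < s.1
    · let t : ActState n := ⟨s.1 - 1, Finset.mem_Icc.2 ⟨by omega, by omega⟩⟩
      have key : ∀ s', M.actTrans .rest s s' = (if s' = t then M.ρ s.1 (s.1 - 1) else 0)
          + (if s' = s then 1 - M.ρ s.1 (s.1 - 1) else 0) := by
        intro s'
        simp only [actTrans, h, true_and, Subtype.ext_iff, t]
        split_ifs <;> first | omega | simp
      simp [key, Finset.sum_add_distrib]
    · have key : ∀ s', M.actTrans .rest s s' = if s' = s then 1 else 0 := by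
        intro s'
        simp only [actTrans, h, false_and, if_false, Subtype.ext_iff]
        split_ifs <;> first | omega | simp
      simp [key]
  · by_cases h : s.1 < n
    · let t : ActState n := ⟨s.1 + 1, Finset.mem_Icc.2 ⟨by omega, by omega⟩⟩
      have key : ∀ s', M.actTrans .work s s' = (if s' = t then M.ρ s.1 (s.1 + 1) else 0)
          + (if s' = s then 1 - M.ρ s.1 (s.1 + 1) else 0) := by
        intro s'
        simp only [actTrans, h, true_and, Subtype.ext_iff, t]
        split_ifs <;> first | omega | simp
      simp [key, Finset.sum_add_distrib]
    · have key : ∀ s', M.actTrans .work s s' = if s' = s then 1 else 0 := by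
        intro s'
        simp only [actTrans, h, false_and, if_false, Subtype.ext_iff]
        split_ifs <;> first | omega | simp
      simp [key]

lemma actTrans_self_pos (M : Model n) (a : Action) (s : ActState n) : 0 < M.actTrans a s s := by
  have hs := Finset.mem_Icc.1 s.2
  cases a
  · by_cases h : 1 < s.1
    · have hne : s.1 ≠ s.1 - 1 := by omega
      simpa [actTrans, h, hne] using (M.ρ_down_mem s.1 h hs.2).2
    · have h1 : s.1 = 1 := by omega
      simp [actTrans, h1]
  · by_cases h : s.1 < n
    · simpa [actTrans, h] using (M.ρ_up_mem s.1 hs.1 h).2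
    · have h1 : s.1 = n := by omega
      simp [actTrans, h1]

lemma actTrans_work_succ_pos (M : Model n) {s s' : ActState n} (h : s'.1 = s.1 + 1) :
    0 < M.actTrans .work s s' := by
  have hs := Finset.mem_Icc.1 s.2
  have hs' := Finset.mem_Icc.1 s'.2
  have hn : s.1 < n := by omega
  simpa [actTrans, hn, h] using (M.ρ_up_mem s.1 hs.1 hn).1

lemma actTrans_rest_pred_pos (M : Model n) {s s' : ActState n} (h : s.1 = s'.1 + 1) :
    0 < M.actTrans .rest s s' := by
  have hs := Finset.mem_Icc.1 s.2
  have hs' := Finset.mem_Icc.1 s'.2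
  have h1 : 1 < s.1 := by omega
  have h2 : s'.1 = s.1 - 1 := by omega
  simpa [actTrans, h1, h2] using (M.ρ_down_mem s.1 h1 hs.2).1

lemma auxAvailTrans_nonneg (M : Model n) (a : Action) (s : ActState n) (w : Avail) :
    0 ≤ M.auxAvailTrans a s w := by
  have := M.μ_mem s
  cases a <;> cases w <;> simp only [auxAvailTrans] <;> linarith [this.1, this.2]

lemma sum_auxAvailTrans (M : Model n) (a : Action) (s : ActState n) :
    ∑ w, M.auxAvailTrans a s w = 1 := by
  cases a <;> simp [sum_avail, auxAvailTrans]

lemma auxTrans_nonneg (M : Model n) (a : Action) (y y' : ServerState n) :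
    0 ≤ M.auxTrans a y y' :=
  mul_nonneg (M.actTrans_nonneg _ _ _) (M.auxAvailTrans_nonneg _ _ _)

lemma sum_auxTrans (M : Model n) (a : Action) (y : ServerState n) :
    ∑ y', M.auxTrans a y y' = 1 := by
  simp only [auxTrans, Fintype.sum_prod_type, ← Finset.mul_sum, sum_auxAvailTrans, mul_one,
    sum_actTrans]

lemma auxChain_phi (M : Model n) (τ : ℕ) (y y' : ServerState n) :
    M.auxChain (phi τ) y y' = M.auxTrans (serverAction τ y) y y' := by
  unfold auxChain phi serverAction
  split_ifs <;> simp

lemma sysChain_theta (M : Model n) (lam : ℝ) (τ : ℕ) (x x' : SysState n) :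
    M.sysChain lam (theta τ) x x' = ENNReal.ofReal (M.sysTrans lam (sysAction τ x) x x') := by
  unfold sysChain theta phi sysAction serverAction
  split_ifs <;> simp

lemma availQueueTrans_nonneg (M : Model n) {lam : ℝ} (hlam : lam ∈ Set.Ioo (0 : ℝ) 1)
    (a : Action) (s : ActState n) (q : ℕ) (w' : Avail) (q' : ℕ) :
    0 ≤ M.availQueueTrans lam a s q w' q' := by
  obtain ⟨h1, h2⟩ := M.μ_mem s
  obtain ⟨h3, h4⟩ := hlam
  cases a <;> cases w' <;> simp only [availQueueTrans, le_refl] <;> split_ifs <;>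
    first | linarith | (apply mul_nonneg <;> linarith)

lemma sysTrans_nonneg (M : Model n) {lam : ℝ} (hlam : lam ∈ Set.Ioo (0 : ℝ) 1)
    (a : Action) (x x' : SysState n) : 0 ≤ M.sysTrans lam a x x' :=
  mul_nonneg (M.actTrans_nonneg _ _ _) (M.availQueueTrans_nonneg hlam _ _ _ _ _)

/-- The expected value of an affine function of the next queue size, on the event that the next
availability is `w'`. Working on an empty queue is excluded. -/
lemma hasSum_availQueueTrans (M : Model n) (lam : ℝ) (a : Action) (s : ActState n) (q : ℕ)
    (ha : a = .work → 0 < q) (w' : Avail) (α β : ℝ) :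
    HasSum (fun q' : ℕ => M.availQueueTrans lam a s q w' q' * (α * q' + β))
      (M.auxAvailTrans a s w' * (α * (q + lam) + β)
        - if a = .work ∧ w' = .available then α * M.μ s else 0) := by
  have two : ∀ (f : ℕ → ℝ) (i j : ℕ) (c d : ℝ), i ≠ j →
      (∀ k, f k = if k = i then c else if k = j then d else 0) →
      HasSum (fun q' : ℕ => f q' * (α * q' + β)) (c * (α * i + β) + d * (α * j + β)) := by
    intro f i j c d hij hf
    convert (hasSum_ite_eq i (c * (α * i + β))).add (hasSum_ite_eq j (d * (α * j + β))) using 2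
      with k
    rw [hf]
    split_ifs <;> simp_all
  cases a <;> cases w'
  · convert two (M.availQueueTrans lam .rest s q .available) (q + 1) q lam (1 - lam)
      (by omega) (fun k => rfl) using 1
    simp [auxAvailTrans]
    ring
  · simp [availQueueTrans, auxAvailTrans]
  · obtain ⟨p, rfl⟩ : ∃ p, q = p + 1 := ⟨q - 1, by have := ha rfl; omega⟩
    convert two (M.availQueueTrans lam .work s (p + 1) .available) (p + 1) p (M.μ s * lam)
      (M.μ s * (1 - lam)) (by omega)
      (fun k => by simp [availQueueTrans]) using 1
    simp [auxAvailTrans]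
    ring
  · convert two (M.availQueueTrans lam .work s q .busy) (q + 1) q ((1 - M.μ s) * lam)
      ((1 - M.μ s) * (1 - lam)) (by omega) (fun k => rfl) using 1
    simp [auxAvailTrans]
    ring

/-- The expected value, after one step, of a function that is affine in the queue size with a slope
that does not depend on the server state. -/
lemma tsum_sysTrans (M : Model n) {lam : ℝ} (hlam : lam ∈ Set.Ioo (0 : ℝ) 1) (a : Action)
    (x : SysState n) (ha : a = .work → 0 < x.1.2.2) {α : ℝ} (hα : 0 ≤ α)
    {h : ServerState n → ℝ} (hh : ∀ y, 0 ≤ h y) :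
    ∑' z : SysState n, ENNReal.ofReal (M.sysTrans lam a x z)
        * ENNReal.ofReal (α * z.1.2.2 + h (z.1.1, z.1.2.1))
      = ENNReal.ofReal (α * (x.1.2.2 + lam) - (if a = .work then α * M.μ x.1.1 else 0)
          + ∑ y, M.auxTrans a (x.1.1, x.1.2.1) y * h y) := by
  obtain ⟨⟨s, w, q⟩, hx⟩ := x
  simp only at ha ⊢
  let f : ActState n → Avail → ℕ → ℝ := fun s' w' q' =>
    M.actTrans a s s' * (M.availQueueTrans lam a s q w' q' * (α * q' + h (s', w')))
  have hf0 : ∀ s' w' q', 0 ≤ f s' w' q' := fun s' w' q' =>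
    mul_nonneg (M.actTrans_nonneg _ _ _) (mul_nonneg (M.availQueueTrans_nonneg hlam _ _ _ _ _)
      (add_nonneg (mul_nonneg hα q'.cast_nonneg) (hh _)))
  have hfsum : ∀ s' w', HasSum (f s' w') (M.actTrans a s s' * (M.auxAvailTrans a s w'
      * (α * (q + lam) + h (s', w'))
        - if a = .work ∧ w' = .available then α * M.μ s else 0)) := fun s' w' =>
    (M.hasSum_availQueueTrans lam a s q ha w' α (h (s', w'))).mul_left _
  have hsupp : (Function.support fun z : ActState n × Avail × ℕ =>
      ENNReal.ofReal (f z.1 z.2.1 z.2.2)) ⊆ {z | z.2 ≠ (Avail.busy, 0)} := by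
    rintro ⟨s', w', q'⟩ hz hz'
    obtain ⟨rfl, rfl⟩ := Prod.mk.inj hz'
    apply hz
    have : M.availQueueTrans lam a s q .busy 0 = 0 := by
      cases a
      · rfl
      · have := ha rfl
        simp only [availQueueTrans]
        rw [if_neg (by omega), if_neg (by omega)]
    simp [f, this]
  calc ∑' z : SysState n, ENNReal.ofReal (M.sysTrans lam a ⟨(s, w, q), hx⟩ z)
        * ENNReal.ofReal (α * z.1.2.2 + h (z.1.1, z.1.2.1))
      = ∑' z : SysState n, ENNReal.ofReal (f z.1.1 z.1.2.1 z.1.2.2) := by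
        refine tsum_congr fun z => ?_
        rw [← ENNReal.ofReal_mul (M.sysTrans_nonneg hlam _ _ _)]
        simp only [sysTrans, f, mul_assoc]
    _ = ∑' z : ActState n × Avail × ℕ, ENNReal.ofReal (f z.1 z.2.1 z.2.2) :=
        tsum_subtype_eq_of_support_subset hsupp
    _ = ∑ s', ∑ w', ∑' q', ENNReal.ofReal (f s' w' q') := by
        rw [ENNReal.tsum_prod (f := fun s' (p : Avail × ℕ) => ENNReal.ofReal (f s' p.1 p.2)),
          tsum_fintype]
        refine Finset.sum_congr rfl fun s' _ => ?_
        rw [ENNReal.tsum_prod (f := fun w' q' => ENNReal.ofReal (f s' w' q')), tsum_fintype]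
    _ = ENNReal.ofReal (∑ s', ∑ w', ∑' q', f s' w' q') := by
        rw [ENNReal.ofReal_sum_of_nonneg fun s' _ => Finset.sum_nonneg fun w' _ =>
          tsum_nonneg (hf0 s' w')]
        refine Finset.sum_congr rfl fun s' _ => ?_
        rw [ENNReal.ofReal_sum_of_nonneg fun w' _ => tsum_nonneg (hf0 s' w')]
        refine Finset.sum_congr rfl fun w' _ => ?_
        rw [ENNReal.ofReal_tsum_of_nonneg (hf0 s' w') (hfsum s' w').summable]
    _ = _ := by
        congr 1
        simp only [fun s' w' => (hfsum s' w').tsum_eq]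
        have hrow : ∀ s', ∑ w', M.actTrans a s s' * (M.auxAvailTrans a s w'
            * (α * (q + lam) + h (s', w'))
              - if a = .work ∧ w' = .available then α * M.μ s else 0)
            = M.actTrans a s s' * (α * (q + lam) - if a = .work then α * M.μ s else 0)
              + ∑ w', M.actTrans a s s' * M.auxAvailTrans a s w' * h (s', w') := by
          intro s'
          have := M.sum_auxAvailTrans a s
          simp only [sum_avail] at this ⊢
          simp only [and_true, reduceCtorEq, and_false, if_false]
          linear_combination (M.actTrans a s s' * (α * (q + lam))) * this
        simp only [hrow, Finset.sum_add_distrib, ← Finset.sum_mul, sum_actTrans, one_mul,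
          Fintype.sum_prod_type, auxTrans]

lemma work_pos_queue {τ : ℕ} {x : SysState n} (h : sysAction τ x = .work) : 0 < x.1.2.2 := by
  unfold sysAction at h
  split_ifs at h with h0
  exact h0

lemma tsum_sysChain_theta (M : Model n) {lam : ℝ} (hlam : lam ∈ Set.Ioo (0 : ℝ) 1) (τ : ℕ)
    (x : SysState n) : ∑' z, M.sysChain lam (theta τ) x z = 1 := by
  have := M.tsum_sysTrans hlam (sysAction τ x) x work_pos_queue le_rfl
    (h := fun _ => 1) (fun _ => zero_le_one)
  simp only [zero_mul, zero_add, ENNReal.ofReal_one, mul_one, sum_auxTrans, ite_self,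
    sub_zero] at this
  simpa only [sysChain_theta] using this

/-! ### Accessibility -/

/-- In the auxiliary chain, the server state with the largest activity level at which the
threshold policy works when available (or the lowest level, if there is none) is accessible from
every state. -/
lemma exists_reflTransGen_auxChain (M : Model n) (hn : 1 ≤ n) {τ : ℕ} (hτ : τ ≤ n + 1) :
    ∃ o : ServerState n, ∀ y,
      Relation.ReflTransGen (fun y z => 0 < M.auxChain (phi τ) y z) y o := by
  let o : ActState n := ⟨max (τ - 1) 1, Finset.mem_Icc.2 ⟨le_max_right _ _, by omega⟩⟩
  have step : ∀ (s s' : ActState n) w w' (a : Action), serverAction τ (s, w) = a →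
      0 < M.actTrans a s s' → 0 < M.auxAvailTrans a s w' →
      0 < M.auxChain (phi τ) (s, w) (s', w') := by
    rintro s s' w w' a rfl h1 h2
    rw [auxChain_phi]
    exact mul_pos h1 h2
  have habove : ∀ k (s : ActState n), s.1 = o.1 + k →
      Relation.ReflTransGen (fun y z => 0 < M.auxChain (phi τ) y z) (s, .available)
        (o, .available) := by
    intro k
    induction k with
    | zero =>
      intro s hs
      rw [Subtype.ext (a1 := s) (a2 := o) hs]
    | succ k ih =>
      intro s hs
      have h1 := Finset.mem_Icc.1 s.2
      have h2 : o.1 = max (τ - 1) 1 := rfl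
      let t : ActState n := ⟨s.1 - 1, Finset.mem_Icc.2 ⟨by omega, by omega⟩⟩
      refine Relation.ReflTransGen.head (step s t _ .available .rest ?_ ?_ ?_)
        (ih t (by simp only [t]; omega))
      · exact if_pos ⟨by simp only; omega, rfl⟩
      · exact M.actTrans_rest_pred_pos (by simp only [t]; omega)
      · exact one_pos
  have hbelow : ∀ k (s : ActState n), s.1 + k = o.1 →
      Relation.ReflTransGen (fun y z => 0 < M.auxChain (phi τ) y z) (s, .available)
        (o, .available) := by
    intro k
    induction k with
    | zero =>
      intro s hs
      rw [Subtype.ext (a1 := s) (a2 := o) hs]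
    | succ k ih =>
      intro s hs
      have h1 := Finset.mem_Icc.1 s.2
      have h2 : o.1 = max (τ - 1) 1 := rfl
      have h3 := Finset.mem_Icc.1 o.2
      let t : ActState n := ⟨s.1 + 1, Finset.mem_Icc.2 ⟨by omega, by omega⟩⟩
      refine Relation.ReflTransGen.head (step s t _ .available .work ?_ ?_ ?_)
        (ih t (by simp only [t]; omega))
      · exact if_neg fun h => by have := h.1; simp only at this; omega
      · exact M.actTrans_work_succ_pos rfl
      · exact (M.μ_mem s).1
  have havail : ∀ s, Relation.ReflTransGen (fun y z => 0 < M.auxChain (phi τ) y z)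
      (s, .available) (o, .available) := by
    intro s
    rcases le_total s.1 o.1 with h | h
    · exact hbelow (o.1 - s.1) s (by omega)
    · exact habove (s.1 - o.1) s (by omega)
  refine ⟨(o, .available), ?_⟩
  rintro ⟨s, _ | _⟩
  · exact havail s
  · exact Relation.ReflTransGen.head (step s s _ .available .work (if_neg (by simp))
      (M.actTrans_self_pos _ _) (M.μ_mem s).1) (havail s)

/-- If the threshold policy works at the lowest activity level, then all states of the system
communicate: they communicate with the empty system at that level. -/
lemma accessible_sysChain_theta (M : Model n) (hn : 1 ≤ n) {lam : ℝ}
    (hlam : lam ∈ Set.Ioo (0 : ℝ) 1) {τ : ℕ} (hτ : 2 ≤ τ) (x y : SysState n) :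
    Accessible (M.sysChain lam (theta τ)) x y := by
  refine accessible_of_reflTransGen ?_
  set R : SysState n → SysState n → Prop := fun x z => 0 < M.sysChain lam (theta τ) x z
  let A : ActState n → ℕ → SysState n := fun s q => ⟨(s, .available, q), by simp⟩
  let B : ActState n → ℕ → SysState n := fun s q => ⟨(s, .busy, q + 1), by simp⟩
  let l : ActState n := ⟨1, Finset.mem_Icc.2 ⟨le_rfl, hn⟩⟩
  have hlam' : 0 < 1 - lam := sub_pos.2 hlam.2
  have hμ : ∀ s, 0 < M.μ s := fun s => (M.μ_mem s).1
  have hμ' : ∀ s, 0 < 1 - M.μ s := fun s => sub_pos.2 (M.μ_mem s).2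
  have step : ∀ (x z : SysState n) (a : Action), sysAction τ x = a →
      0 < M.actTrans a x.1.1 z.1.1 →
      0 < M.availQueueTrans lam a x.1.1 x.1.2.2 z.1.2.1 z.1.2.2 → R x z := by
    rintro x z a rfl h1 h2
    simp only [R, sysChain_theta]
    exact ENNReal.ofReal_pos.2 (mul_pos h1 h2)
  have hworkA : ∀ (s : ActState n) q, s.1 < τ → sysAction τ (A s (q + 1)) = .work := by
    intro s q hs
    simp [sysAction, serverAction, A, hs]
  have hworkB : ∀ (s : ActState n) q, sysAction τ (B s q) = .work := by
    intro s q
    simp [sysAction, serverAction, B]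
  have hrest : ∀ (s : ActState n) q, τ ≤ s.1 → sysAction τ (A s q) = .rest := by
    intro s q hs
    simp [sysAction, serverAction, A, hs]
  have hrest0 : ∀ s : ActState n, sysAction τ (A s 0) = .rest := by
    intro s
    simp [sysAction, A]
  have hpred : ∀ s : ActState n, s.1 ≠ 1 → ∃ t : ActState n, s.1 = t.1 + 1 := by
    intro s hs
    have := Finset.mem_Icc.1 s.2
    exact ⟨⟨s.1 - 1, Finset.mem_Icc.2 ⟨by omega, by omega⟩⟩, by simp only; omega⟩
  have hempty : ∀ k (s : ActState n), s.1 = k → Relation.ReflTransGen R (A s 0) (A l 0) := by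
    intro k
    induction k with
    | zero =>
      intro s hs
      have := Finset.mem_Icc.1 s.2
      omega
    | succ k ih =>
      intro s hs
      by_cases h : s.1 = 1
      · rw [Subtype.ext (a1 := s) (a2 := l) h]
      · obtain ⟨t, ht⟩ := hpred s h
        refine .head (step _ (A t 0) _ (hrest0 s) (M.actTrans_rest_pred_pos ht) ?_)
          (ih t (by omega))
        simpa [availQueueTrans, A] using hlam'
  have hdownA : ∀ q (s : ActState n), Relation.ReflTransGen R (A s q) (A l 0) := by
    intro q
    induction q with
    | zero => exact fun s => hempty _ s rfl
    | succ q ihq =>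
      have : ∀ k (s : ActState n), s.1 = k → Relation.ReflTransGen R (A s (q + 1)) (A l 0) := by
        intro k
        induction k with
        | zero =>
          intro s hs
          have := Finset.mem_Icc.1 s.2
          omega
        | succ k ih =>
          intro s hs
          by_cases h : s.1 < τ
          · refine .head (step _ (A s q) _ (hworkA s q h) (M.actTrans_self_pos _ _) ?_) (ihq s)
            simpa [availQueueTrans, A] using mul_pos (hμ s) hlam'
          · obtain ⟨t, ht⟩ := hpred s (by omega)
            refine .head (step _ (A t (q + 1)) _ (hrest s _ (by omega))
              (M.actTrans_rest_pred_pos ht) ?_) (ih t (by omega))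
            simpa [availQueueTrans, A] using hlam'
      exact fun s => this _ s rfl
  have hdown : ∀ x, Relation.ReflTransGen R x (A l 0) := by
    rintro ⟨⟨s, w, q⟩, hx⟩
    cases w
    · exact hdownA q s
    · obtain _ | q := q
      · exact absurd rfl hx
      · refine .head (step (B s q) (A s q) _ (hworkB s q) (M.actTrans_self_pos _ _) ?_)
          (hdownA q s)
        simpa [availQueueTrans, A, B] using mul_pos (hμ s) hlam'
  have hupl : ∀ q, Relation.ReflTransGen R (A l 0) (B l q) := by
    intro q
    induction q with
    | zero =>
      refine .head (step _ (A l 1) _ (hrest0 l) (M.actTrans_self_pos _ _) ?_)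
        (.single (step _ (B l 0) _ (hworkA l 0 (by simp only [l]; omega))
          (M.actTrans_self_pos _ _) ?_))
      · simpa [availQueueTrans, A] using hlam.1
      · simpa [availQueueTrans, A, B] using mul_pos (hμ' l) hlam'
    | succ q ih =>
      refine .tail ih (step _ (B l (q + 1)) _ (hworkB l q) (M.actTrans_self_pos _ _) ?_)
      simpa [availQueueTrans, B] using mul_pos (hμ' l) hlam.1
  have hupB : ∀ q k (s : ActState n), s.1 = k → Relation.ReflTransGen R (A l 0) (B s q) := by
    intro q k
    induction k with
    | zero =>
      intro s hs
      have := Finset.mem_Icc.1 s.2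
      omega
    | succ k ih =>
      intro s hs
      by_cases h : s.1 = 1
      · rw [Subtype.ext (a1 := s) (a2 := l) h]
        exact hupl q
      · obtain ⟨t, ht⟩ := hpred s h
        refine .tail (ih t (by omega)) (step _ (B s q) _ (hworkB t q)
          (M.actTrans_work_succ_pos ht) ?_)
        simpa [availQueueTrans, B] using mul_pos (hμ' t) hlam'
  have hup : ∀ y, Relation.ReflTransGen R (A l 0) y := by
    rintro ⟨⟨s, w, q⟩, hx⟩
    cases w
    · refine .tail (hupB q _ s rfl) (step _ (A s q) _ (hworkB s q) (M.actTrans_self_pos _ _) ?_)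
      simpa [availQueueTrans, A, B] using mul_pos (hμ s) hlam'
    · obtain _ | q := q
      · exact absurd rfl hx
      · exact hupB q _ s rfl
  exact (hdown x).trans (hup y)

/-! ### Stability below the service rate -/

lemma existsUnique_isStationaryPMF_auxChain (M : Model n) (hn : 1 ≤ n) {τ : ℕ}
    (hτ : τ ≤ n + 1) : ∃! π : ServerState n → ℝ, IsStationaryPMF (M.auxChain (phi τ)) π := by
  obtain ⟨o, ho⟩ := M.exists_reflTransGen_auxChain hn hτ
  have : Nonempty (ServerState n) := ⟨o⟩
  refine existsUnique_isStationaryPMF (fun y z => ?_) (fun y => ?_) o ho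
  · rw [auxChain_phi]
    exact M.auxTrans_nonneg _ _ _
  · simp only [auxChain_phi, sum_auxTrans]

/-- A server that never starts to work has service rate zero: by stationarity, the flow out of the
busy states equals the flow into them, which comes from busy states only. -/
lemma serviceRate_eq_zero (M : Model n) (hn : 1 ≤ n) {τ : ℕ} (hτ : τ ≤ 1) :
    M.serviceRate τ = 0 := by
  have hπ : IsStationaryPMF (M.auxChain (phi τ)) (M.piBar τ) :=
    Classical.epsilon_spec (M.existsUnique_isStationaryPMF_auxChain hn (by omega)).exists
  have hτs : ∀ s : ActState n, τ ≤ s.1 := fun s => hτ.trans (Finset.mem_Icc.1 s.2).1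
  have hbal : ∑ s, M.piBar τ (s, .busy) = ∑ s, M.piBar τ (s, .busy) * (1 - M.μ s) := by
    calc ∑ s, M.piBar τ (s, .busy)
        = ∑ s, ∑ y, M.piBar τ y * M.auxChain (phi τ) y (s, .busy) :=
          Finset.sum_congr rfl fun s _ => hπ.2.2 _
      _ = ∑ y, M.piBar τ y * M.auxAvailTrans (serverAction τ y) y.1 .busy := by
          rw [Finset.sum_comm]
          refine Finset.sum_congr rfl fun y _ => ?_
          simp only [auxChain_phi, auxTrans, ← Finset.mul_sum, ← Finset.sum_mul, sum_actTrans,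
            one_mul]
      _ = _ := by
          rw [Fintype.sum_prod_type]
          refine Finset.sum_congr rfl fun s _ => ?_
          simp [sum_avail, serverAction, hτs, auxAvailTrans]
  simp only [mul_sub, mul_one, Finset.sum_sub_distrib] at hbal
  have hrest : ∀ s : ActState n, phi τ (s, .available) = 0 := fun s => if_pos ⟨hτs s, rfl⟩
  have hwork : ∀ s : ActState n, phi τ (s, .busy) = 1 := fun s => if_neg (by simp)
  simp only [serviceRate, Fintype.sum_prod_type, sum_avail, hrest, hwork, mul_zero, zero_mul,
    mul_one, zero_add]
  linarith

/-- Below its service rate, a threshold policy stabilizes the system. The Lyapunov function is the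
queue size corrected by a solution of the Poisson equation of the auxiliary chain, which replaces
the current service probability by its long-term average. -/
theorem stabilizes_theta (M : Model n) (hn : 1 ≤ n) {τ : ℕ} (hτ : τ ≤ n + 1) {lam : ℝ}
    (hlam : lam ∈ Set.Ioo (0 : ℝ) 1) (hlt : lam < M.serviceRate τ) :
    M.Stabilizes lam (theta τ) := by
  have hτ2 : 2 ≤ τ := by
    by_contra! h
    rw [M.serviceRate_eq_zero hn (by omega)] at hlt
    exact lt_asymm hlt hlam.1
  have hex := M.existsUnique_isStationaryPMF_auxChain hn hτ
  have hπ : IsStationaryPMF (M.auxChain (phi τ)) (M.piBar τ) := Classical.epsilon_spec hex.exists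
  obtain ⟨h, hh0, hh⟩ := exists_poisson_solution
    (fun y z => by rw [auxChain_phi]; exact M.auxTrans_nonneg _ _ _)
    (fun y => by simp only [auxChain_phi, sum_auxTrans]) hπ (fun σ hσ => hex.unique hσ hπ)
    (fun y => phi τ y * M.μ y.1)
  simp only [← mul_assoc] at hh
  change ∀ y, _ = _ - M.serviceRate τ at hh
  -- Scaling by the inverse of `δ` normalizes the drift to `-1`.
  set δ := M.serviceRate τ - lam with hδ
  have hδ0 : 0 < δ := sub_pos.2 hlt
  have hα : 0 ≤ δ⁻¹ := inv_nonneg.2 hδ0.le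
  let V : SysState n → ℝ≥0∞ := fun x =>
    ENNReal.ofReal (δ⁻¹ * x.1.2.2 + δ⁻¹ * h (x.1.1, x.1.2.1))
  have hPV : ∀ x, ∑' z, M.sysChain lam (theta τ) x z * V z = _ := fun x => by
    simpa only [sysChain_theta] using M.tsum_sysTrans hlam (sysAction τ x) x work_pos_queue hα
      (h := fun y => δ⁻¹ * h y) (fun y => mul_nonneg hα (hh0 y))
  let l : ActState n := ⟨1, Finset.mem_Icc.2 ⟨le_rfl, hn⟩⟩
  have : Nonempty (SysState n) := ⟨⟨(l, .available, 0), by simp⟩⟩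
  refine ⟨isAdmissible_theta τ, isStable_of_forall_isPositiveRecurrent fun y =>
    isPositiveRecurrent_of_foster (M.tsum_sysChain_theta hlam τ) V (fun x => ?_)
      (C := {x | x.1.2.2 = 0}) ?_ (fun x hx => ?_) y
      fun x => M.accessible_sysChain_theta hn hlam hτ2 x y⟩
  · rw [hPV]
    exact ENNReal.ofReal_ne_top
  · refine Set.Finite.of_injOn (f := fun x : SysState n => (x.1.1, x.1.2.1))
      (t := (Set.univ : Set (ServerState n))) (fun _ _ => Set.mem_univ _) ?_ Set.finite_univ
    rintro ⟨⟨s, w, q⟩, hx⟩ hq ⟨⟨s', w', q'⟩, hx'⟩ hq' heq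
    change q = 0 at hq
    change q' = 0 at hq'
    simp only [Prod.mk.injEq] at heq
    simp [hq, hq', heq]
  · have hq : 0 < x.1.2.2 := Nat.pos_of_ne_zero hx
    have hact : sysAction τ x = serverAction τ (x.1.1, x.1.2.1) := if_pos hq
    have hP := hh (x.1.1, x.1.2.1)
    simp only [auxChain_phi] at hP
    have hmu : (if sysAction τ x = .work then δ⁻¹ * M.μ x.1.1 else 0)
        = δ⁻¹ * (phi τ (x.1.1, x.1.2.1) * M.μ x.1.1) := by
      rw [hact, ite_serverAction]
      ring
    have hsum : ∑ y, M.auxTrans (sysAction τ x) (x.1.1, x.1.2.1) y * (δ⁻¹ * h y)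
        = δ⁻¹ * (h (x.1.1, x.1.2.1) + phi τ (x.1.1, x.1.2.1) * M.μ x.1.1
          - M.serviceRate τ) := by
      rw [← hP, hact, Finset.mul_sum]
      exact Finset.sum_congr rfl fun y _ => by ring
    have hval : δ⁻¹ * (x.1.2.2 + lam) - (if sysAction τ x = .work then δ⁻¹ * M.μ x.1.1 else 0)
        + ∑ y, M.auxTrans (sysAction τ x) (x.1.1, x.1.2.1) y * (δ⁻¹ * h y)
        = δ⁻¹ * x.1.2.2 + δ⁻¹ * h (x.1.1, x.1.2.1) - 1 := by
      have h1 : δ⁻¹ * δ = 1 := inv_mul_cancel₀ hδ0.ne'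
      rw [hmu, hsum]
      rw [hδ] at h1 ⊢
      linear_combination -h1
    have hnn : 0 ≤ δ⁻¹ * x.1.2.2 + δ⁻¹ * h (x.1.1, x.1.2.1) - 1 := by
      rw [← hval]
      have h1 : (if sysAction τ x = .work then δ⁻¹ * M.μ x.1.1 else 0) ≤ δ⁻¹ * 1 := by
        split_ifs
        · exact mul_le_mul_of_nonneg_left (M.μ_mem _).2.le hα
        · linarith
      have h2 : δ⁻¹ * 1 ≤ δ⁻¹ * (x.1.2.2 + lam) := by
        have : (1 : ℝ) ≤ x.1.2.2 := by exact_mod_cast hq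
        exact mul_le_mul_of_nonneg_left (by linarith [hlam.1]) hα
      have h3 := Finset.sum_nonneg fun (y : ServerState n) (_ : y ∈ Finset.univ) =>
        mul_nonneg (M.auxTrans_nonneg (sysAction τ x) (x.1.1, x.1.2.1) y)
          (mul_nonneg hα (hh0 y))
      linarith
    rw [hPV, hval, ← ENNReal.ofReal_one, ← ENNReal.ofReal_add hnn zero_le_one]
    exact ENNReal.ofReal_le_ofReal (by linarith)

end Model

end ActionQueue

theorem theorem2 (n : ℕ) (hn : 1 ≤ n) (M : ActionQueue.Model n) :
    (∀ τ ∈ Finset.Icc 1 (n + 1),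
      ∃! π : ActionQueue.ServerState n → ℝ,
        MarkovChain.IsStationaryPMF (M.auxChain (ActionQueue.phi τ)) π) ∧
    ∀ τstar ∈ Finset.Icc 1 (n + 1), M.serviceRate τstar = M.lambdaStar →
      ∀ lam : ℝ, lam ∈ Set.Ioo (0 : ℝ) 1 → lam < M.lambdaStar →
        M.Stabilizes lam (ActionQueue.theta τstar) := by
  refine ⟨fun τ hτ => M.existsUnique_isStationaryPMF_auxChain hn (Finset.mem_Icc.1 hτ).2,
    fun τ hτ hmax lam hlam hlt => ?_⟩
  rw [← hmax] at hlt
  exact M.stabilizes_theta hn (Finset.mem_Icc.1 hτ).2 hlam hlt
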